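/- For positive integers $a_1,\dots,a_n$ let $\mathrm{NR}(a_1,\dots,a_n)$ be the set of positive integers that are not of the form $c_1a_1+\cdots+c_na_n$ with nonnegative integers $c_i$, and, when this set is finite, let $s(a_1,\dots,a_n)=\sum_{m\in \mathrm{NR}(a_1,\dots,a_n)} m$ be the Sylvester sum. Let $a,d,K,k$ be positive integers with $a\ge 2$, $\gcd(a,d)=1$, $\frac{k-1}{2}<K\le\frac{2k-2}{3}$ and $\left\lfloor\frac{a+K}{k}\right\rfloor\ge 2$, and let $r=a+K-\left\lfloor\frac{a+K}{k}\right\rfloor k$. Then $\mathrm{NR}(a,a+(K+1)d,a+(K+2)d,\dots,a+kd)$ is finite, and $s=s\bigl(a,a+(K+1)d,a+(K+2)d,\dots,a+kd\bigr)$ is given as follows. If $0\le r\le k-K-1$, then \begin{align*} s&=\frac{1}{12k^2}\Bigl(2a^4+6(3K-k)a^3+\bigl(30K^2-7k^2+12k-6(r+4K-3k)r\bigr)a^2\\ &\quad+\bigl(K^2(14K+6k)-4Kk(8k-3)+12k^2(k-1)+4r^3+6(K-2k)r^2\\ &\qquad-(24K^2-6Kk-8k^2+12k)r\bigr)a-k^2\\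 &\quad+\bigl(2a^2+3(6K-2k+1)a+6K(5K+7)-(6k^2+6k-13)\bigr)k^2d^2\\ &\quad+\bigl(4a^3+3(12K-4k+1)a^2+\bigl(6K(10K+7)-(13k^2-6k-12)-6r(r+4K-3k)\bigr)a\\ &\qquad+28K^3-K^2(27k-39)-K(7k^2+45k-12)+6(k-1)k(k+2)\\ &\qquad+2r^3-3r^2(2K+k+1)+r\bigl(-6K(4K-k+6)+7k^2+9k-12\bigr)\bigr)kd\Bigr). \end{align*} If $k-K\le r\le K$, then \begin{align*} s&=\frac{1}{12k^2}\Bigl(2a^4+6(3K-k)a^3+\bigl(30K^2+12Kk-19k^2+24k-6(r+4K-5k)r\bigr)a^2\\ &\quad+\bigl(K^2(14K+18k)-8Kk(4k-3)+4r^3+6(K-4k)r^2\\ &\qquad-(24K^2-6Kk-32k^2+24k)r\bigr)a-k^2\\ &\quad+\bigl(2a^2+3(6K-2k+1)a+6K(5K+7)-6k^2-6k+13\bigr)k^2d^2\\ &\quad+\bigl(4a^3+3(12K-4k+1)a^2+\bigl(6K(10K+2k+7)-(25k^2-18k-12)-6r(r+4K-5k)\bigr)a\\ &\qquad+28K^3-K^2(9k-39)-K(19k^2+15k-12)+2r^3-3r^2(2K+3k+1)\\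 &\qquad+r\bigl(-K(24K-18k+36)+(19k^2+15k-12)\bigr)\bigr)kd\Bigr). \end{align*} If $K+1\le r<k$, then \begin{align*} s&=\frac{1}{12k^2}\Bigl(2a^4+6(3K-k)a^3+\bigl(30K^2+24Kk-19k^2+12k-6(r+4K-3k)r\bigr)a^2\\ &\quad+\bigl(K^2(14K+30k)-4Kk(5k-3)+4r^3+6(K-2k)r^2\\ &\qquad-(24K^2+18Kk-20k^2+12k)r\bigr)a-k^2\\ &\quad+\bigl(2a^2+3(6K-2k+1)a+6K(5K+7)-6k^2-6k+13\bigr)k^2d^2\\ &\quad+\bigl(4a^3+3(12K-4k+1)a^2+\bigl(6K(10K+4k+7)-(25k^2-6k-12)-6r(r+4K-3k)\bigr)a\\ &\qquad+28K^3-3K^2(k-13)-K(7k^2+9k-12)+2r^3-3r^2(2K+k+1)\\ &\qquad+r\bigl(-6K(4K-k+6)+7k^2+9k-12\bigr)\bigr)kd\Bigr). \end{align*} -/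

import Mathlib

/-- The positive integers that are not a combination, with nonnegative integer coefficients, of
elements of `A`. -/
def nonrepresentable (A : Set ℕ) : Set ℕ :=
  {n | 0 < n ∧ n ∉ AddSubmonoid.closure A}

/-- The Sylvester sum of `A`: the sum of the positive integers not representable by `A`.
It is meaningful when `nonrepresentable A` is finite. -/
noncomputable def sylvesterSum (A : Set ℕ) : ℕ :=
  ∑ᶠ n ∈ nonrepresentable A, n

/-- The sequence `a, a + (K + 1) d, a + (K + 2) d, …, a + k d`, as a set. -/
def gapProgression (a d K k : ℕ) : Set ℕ :=
  insert a {n | ∃ j : ℕ, K + 1 ≤ j ∧ j ≤ k ∧ n = a + j * d}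

/-! Using `t` generators other than `a` contributes `t * a + y * d`, where `y` ranges over all of
`[t(K+1), tk]`. Since `3K + 2 ≤ 2k`, these intervals miss exactly the gaps `1..K` and `k+1..2K+1`,
and a non-gap `y` is reached with the least possible `t = ⌈y/k⌉` (`leastWeight_mem`). As `a > 2K +
1`, the Apéry element of the class of `i * d` therefore uses `y = i`, or `y = a + i` when `i` is a
gap (`aperyElement_le`).

The Sylvester sum depends only on the sums of the Apéry elements and of their squares
(`sylvesterSum_eq_of_apery`). Those are combinations of prefix sums of `leastWeight`, which are
polynomial on each block of `k` consecutive `y`. The three ranges of `r` record which blocks contain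
the endpoints. -/

open Finset

/-! ### Apéry sets and the Sylvester sum -/

/-- If `w 0, …, w (a - 1)` are pairwise incongruent modulo `a` and each `w i` is the least element of
its residue class generated by `A ∋ a`, then the positive integers not generated by `A` are the
numbers `w i % a + j * a` with `j < w i / a`. -/
theorem nonrepresentable_eq_image {A : Set ℕ} {a : ℕ} (ha : 0 < a) (haA : a ∈ A) (w : ℕ → ℕ)
    (hmem : ∀ i < a, w i ∈ AddSubmonoid.closure A)
    (hmin : ∀ i < a, ∀ n ∈ AddSubmonoid.closure A, n % a = w i % a → w i ≤ n)
    (hsurj : (range a).image (fun i => w i % a) = range a) :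
    nonrepresentable A =
      ↑(((range a).sigma fun i => range (w i / a)).image fun p => w p.1 % a + p.2 * a) := by
  ext n
  simp only [nonrepresentable, Set.mem_ofPred_eq, coe_image, Set.mem_image, mem_coe, mem_sigma,
    mem_range, Sigma.exists]
  constructor
  · rintro ⟨-, hn⟩
    have h : n % a ∈ (range a).image (fun i => w i % a) := by
      rw [hsurj]; exact mem_range.2 (Nat.mod_lt _ ha)
    obtain ⟨i, hi, hin⟩ := mem_image.1 h
    rw [mem_range] at hi
    have hn' : n % a + n / a * a = n := Nat.mod_add_div' n a
    refine ⟨i, n / a, ⟨hi, ?_⟩, by simp only [hin]; exact hn'⟩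
    by_contra hlt
    apply hn
    have hw : w i % a + w i / a * a = w i := Nat.mod_add_div' _ a
    obtain ⟨c, hc⟩ := Nat.exists_eq_add_of_le (not_lt.1 hlt)
    have hnc : n = w i + c • a := by
      rw [smul_eq_mul, ← hw, ← hn', ← hin, hc]; ring
    rw [hnc]
    exact add_mem (hmem i hi) (nsmul_mem (AddSubmonoid.subset_closure haA) c)
  · rintro ⟨i, j, ⟨hi, hj⟩, rfl⟩
    have hw : w i % a + w i / a * a = w i := Nat.mod_add_div' _ a
    have hlt : w i % a + j * a < w i := by
      have := Nat.mul_lt_mul_of_pos_right hj ha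
      omega
    have hmod : (w i % a + j * a) % a = w i % a := by simp
    have hnot : w i % a + j * a ∉ AddSubmonoid.closure A := fun h =>
      absurd (hmin i hi _ h hmod) (not_le.2 hlt)
    refine ⟨Nat.pos_of_ne_zero fun h0 => hnot ?_, hnot⟩
    rw [h0]; exact zero_mem _

theorem sum_range_cast_rat (n : ℕ) : ∑ i ∈ range n, (i : ℚ) = n * (n - 1) / 2 := by
  induction n with
  | zero => simp
  | succ n ih => rw [sum_range_succ, ih]; push_cast; ring

theorem sum_range_sq_cast_rat (n : ℕ) :
    ∑ i ∈ range n, (i : ℚ) ^ 2 = n * (n - 1) * (2 * n - 1) / 6 := by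
  induction n with
  | zero => simp
  | succ n ih => rw [sum_range_succ, ih]; push_cast; ring

/-- The Sylvester sum in terms of the Apéry set `w 0, …, w (a - 1)`. -/
theorem sylvesterSum_eq_of_apery {A : Set ℕ} {a : ℕ} (ha : 0 < a) (haA : a ∈ A) (w : ℕ → ℕ)
    (hmem : ∀ i < a, w i ∈ AddSubmonoid.closure A)
    (hmin : ∀ i < a, ∀ n ∈ AddSubmonoid.closure A, n % a = w i % a → w i ≤ n)
    (hsurj : (range a).image (fun i => w i % a) = range a) :
    (sylvesterSum A : ℚ) = (∑ i ∈ range a, (w i : ℚ) ^ 2) / (2 * a)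
      - (∑ i ∈ range a, (w i : ℚ)) / 2 + ((a : ℚ) ^ 2 - 1) / 12 := by
  have hinj : Set.InjOn (fun i => w i % a) (range a) :=
    card_image_iff.1 (by rw [hsurj])
  have ha' : (a : ℚ) ≠ 0 := by positivity
  -- The residues `w i % a` permute `0, …, a - 1`.
  have hres (f : ℕ → ℚ) : ∑ i ∈ range a, f (w i % a) = ∑ i ∈ range a, f i := by
    conv_rhs => rw [← hsurj]
    rw [sum_image hinj]
  rw [sylvesterSum, nonrepresentable_eq_image ha haA w hmem hmin hsurj, finsum_mem_coe_finset,
    sum_image, sum_sigma]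
  · have hi (i : ℕ) : ((∑ j ∈ range (w i / a), (w i % a + j * a) : ℕ) : ℚ) =
        (w i : ℚ) ^ 2 / (2 * a) - w i / 2 - ((w i % a : ℕ) : ℚ) ^ 2 / (2 * a)
          + ((w i % a : ℕ) : ℚ) / 2 := by
      have hw : (w i : ℚ) = ((w i % a : ℕ) : ℚ) + ((w i / a : ℕ) : ℚ) * a := by
        exact_mod_cast (Nat.mod_add_div' (w i) a).symm
      push_cast [sum_add_distrib, ← sum_mul]
      rw [sum_range_cast_rat, hw]
      simp only [sum_const, card_range, nsmul_eq_mul]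
      generalize ((w i / a : ℕ) : ℚ) = x
      generalize ((w i % a : ℕ) : ℚ) = y
      field_simp
      ring
    rw [Nat.cast_sum, sum_congr rfl fun i _ => hi i, sum_add_distrib, sum_sub_distrib,
      sum_sub_distrib, hres fun x => (x : ℚ) ^ 2 / (2 * a), hres fun x => (x : ℚ) / 2,
      ← sum_div, ← sum_div, ← sum_div, ← sum_div, sum_range_cast_rat, sum_range_sq_cast_rat]
    field_simp
    ring
  · rintro ⟨i, j⟩ hij ⟨i', j'⟩ hij' h
    simp only [coe_sigma, Set.mem_sigma_iff, mem_coe, mem_range] at hij hij' h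
    have hii : i = i' := by
      apply hinj (by simpa using hij.1) (by simpa using hij'.1)
      simpa using congrArg (· % a) h
    subst hii
    have hjj : j = j' := Nat.eq_of_mul_eq_mul_right ha (by omega)
    rw [hjj]

/-! ### The generated semigroup and its gaps -/

theorem mem_gapProgression (a d K k : ℕ) : a ∈ gapProgression a d K k :=
  Set.mem_insert _ _

theorem mem_closure_gapProgression {a d K k n : ℕ} (hKk : K + 1 ≤ k) :
    n ∈ AddSubmonoid.closure (gapProgression a d K k) ↔
      ∃ c t y, t * (K + 1) ≤ y ∧ y ≤ t * k ∧ n = (c + t) * a + y * d := by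
  constructor
  · intro hn
    induction hn using AddSubmonoid.closure_induction with
    | mem x hx =>
      rcases hx with rfl | ⟨j, hj, hj', rfl⟩
      · exact ⟨1, 0, 0, by simp⟩
      · exact ⟨0, 1, j, by simpa using hj, by simpa using hj', by ring⟩
    | zero => exact ⟨0, 0, 0, by simp⟩
    | add x y _ _ hx hy =>
      obtain ⟨c, t, u, h₁, h₂, rfl⟩ := hx
      obtain ⟨c', t', u', h₁', h₂', rfl⟩ := hy
      refine ⟨c + c', t + t', u + u', ?_, ?_, by ring⟩
      · rw [add_mul]; exact add_le_add h₁ h₁'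
      · rw [add_mul]; exact add_le_add h₂ h₂'
  · rintro ⟨c, t, y, h₁, h₂, rfl⟩
    have ha : a ∈ AddSubmonoid.closure (gapProgression a d K k) :=
      AddSubmonoid.subset_closure (mem_gapProgression a d K k)
    have key : t * a + y * d ∈ AddSubmonoid.closure (gapProgression a d K k) := by
      induction t generalizing y with
      | zero =>
        obtain rfl : y = 0 := by simpa using h₂
        simp
      | succ t ih =>
        have hle : t * (K + 1) ≤ t * k := Nat.mul_le_mul_left _ hKk
        obtain ⟨j, u, hj, hj', hu, hu', rfl⟩ :
            ∃ j u, K + 1 ≤ j ∧ j ≤ k ∧ t * (K + 1) ≤ u ∧ u ≤ t * k ∧ y = u + j := by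
          rw [add_mul, one_mul] at h₁ h₂
          -- Remove the smallest step `K + 1` if the rest then fits below `t * k`; otherwise leave
          -- exactly `t * k`.
          rcases le_total y (t * k + (K + 1)) with h | h
          · exact ⟨K + 1, y - (K + 1), le_rfl, hKk, by omega, by omega, by omega⟩
          · exact ⟨y - t * k, t * k, by omega, by omega, hle, le_rfl, by omega⟩
        have := add_mem (ih u hu hu') (AddSubmonoid.subset_closure
          (show a + j * d ∈ gapProgression a d K k from Or.inr ⟨j, hj, hj', rfl⟩))
        convert this using 1
        ring
    have := add_mem (nsmul_mem ha c) key
    convert this using 1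
    rw [smul_eq_mul]; ring

/-- The least value of `t * a + y * d` with `y ≤ t * k`. -/
def leastWeight (a d k y : ℕ) : ℕ := (y + k - 1) / k * a + y * d

theorem ceil_div_eq {k m y : ℕ} (h₁ : m * k < y) (h₂ : y ≤ (m + 1) * k) :
    (y + k - 1) / k = m + 1 := by
  have hk : 0 < k := by
    rcases Nat.eq_zero_or_pos k with rfl | h
    · omega
    · exact h
  rw [Nat.div_eq_iff hk]
  rw [add_mul, one_mul] at *
  omega

theorem ceil_div_le {k t y : ℕ} (hk : 0 < k) (h : y ≤ t * k) : (y + k - 1) / k ≤ t := by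
  rw [← Nat.lt_succ_iff, Nat.div_lt_iff_lt_mul hk, Nat.succ_mul]
  omega

theorem leastWeight_mono (a d : ℕ) {k x y : ℕ} (h : x ≤ y) :
    leastWeight a d k x ≤ leastWeight a d k y := by
  unfold leastWeight
  gcongr

/-- The `i` in `{1, …, K} ∪ {k + 1, …, 2K + 1}`. -/
def IsGap (K k i : ℕ) : Prop := (1 ≤ i ∧ i ≤ K) ∨ (k + 1 ≤ i ∧ i ≤ 2 * K + 1)

instance (K k : ℕ) : DecidablePred (IsGap K k) := fun i => by unfold IsGap; infer_instance

/-- The intervals for `t = 0, 1` are `{0}` and `[K+1, k]`; from `t = 2` on, `y ≥ 2K + 2` is past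
every gap. -/
theorem not_isGap_of_mul_le {K k t y : ℕ} (h₁ : t * (K + 1) ≤ y)
    (h₂ : y ≤ t * k) : ¬ IsGap K k y := by
  unfold IsGap
  match t with
  | 0 => omega
  | 1 => omega
  | 2 => omega
  | t + 3 =>
    have := Nat.zero_le (t * (K + 1))
    rw [add_mul] at h₁
    omega

/-- For `t = ⌈y/k⌉` only `t(K+1) ≤ y` needs an argument. Avoiding the gaps gives it for `t = 1, 2`.
For `t = m + 3`, `y ≥ (m+2)k + 1 ≥ m(K+1) + 3K + 3`, where `3K + 2 ≤ 2k` enters. -/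
theorem leastWeight_mem {a d K k y : ℕ} (hKk : K + 1 ≤ k) (hKu : 3 * K + 2 ≤ 2 * k)
    (hy : ¬ IsGap K k y) :
    leastWeight a d k y ∈ AddSubmonoid.closure (gapProgression a d K k) := by
  rw [mem_closure_gapProgression hKk]
  have hk : 0 < k := by omega
  refine ⟨0, (y + k - 1) / k, y, ?_, ?_, by rw [zero_add]; rfl⟩
  · rcases Nat.eq_zero_or_pos y with rfl | hpos
    · rw [zero_add, Nat.div_eq_of_lt (by omega), zero_mul]
    · obtain ⟨m, hm⟩ : ∃ m, (y - 1) / k = m := ⟨_, rfl⟩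
      have h₁ : m * k < y := by
        have := Nat.div_mul_le_self (y - 1) k
        rw [hm] at this; omega
      have h₂ : y ≤ (m + 1) * k := by
        have := Nat.lt_mul_of_div_lt (show (y - 1) / k < m + 1 by omega) hk
        omega
      rw [ceil_div_eq h₁ h₂]
      unfold IsGap at hy
      match m with
      | 0 => omega
      | 1 => omega
      | m + 2 =>
        have : m * (K + 1) ≤ m * k := Nat.mul_le_mul_left _ hKk
        rw [add_mul] at *
        rw [add_mul] at *
        omega
  · have := Nat.div_add_mod (y + k - 1) k
    have h := Nat.mod_lt (y + k - 1) hk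
    rw [mul_comm] at this
    omega

/-! ### The Apéry set -/

/-- The least element generated by `gapProgression a d K k` that is congruent to `i * d`
modulo `a`. -/
def aperyElement (a d K k i : ℕ) : ℕ :=
  leastWeight a d k (if IsGap K k i then a + i else i)

theorem aperyElement_mod (a d K k i : ℕ) : aperyElement a d K k i % a = i * d % a := by
  unfold aperyElement leastWeight
  split_ifs
  · rw [add_mul, ← add_assoc, mul_comm a d, ← add_mul, Nat.add_comm, Nat.add_mul_mod_self_right]
  · rw [Nat.add_comm, Nat.add_mul_mod_self_right]

theorem aperyElement_mem {a d K k : ℕ} (hKk : K + 1 ≤ k) (hKu : 3 * K + 2 ≤ 2 * k)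
    (haK : 2 * K + 1 < a) (i : ℕ) :
    aperyElement a d K k i ∈ AddSubmonoid.closure (gapProgression a d K k) := by
  apply leastWeight_mem hKk hKu
  split_ifs with h
  · unfold IsGap; omega
  · exact h

/-- Coprimality forces `y ≡ i` modulo `a` in any representation. A gap `i` excludes `y = i`, so then
`y ≥ a + i`; monotonicity of `leastWeight` concludes. -/
theorem aperyElement_le {a d K k i n : ℕ} (hKk : K + 1 ≤ k) (hgcd : Nat.Coprime a d) (hi : i < a)
    (hn : n ∈ AddSubmonoid.closure (gapProgression a d K k))
    (hmod : n % a = aperyElement a d K k i % a) : aperyElement a d K k i ≤ n := by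
  obtain ⟨c, t, y, h₁, h₂, rfl⟩ := (mem_closure_gapProgression hKk).1 hn
  rw [aperyElement_mod, Nat.add_comm, Nat.add_mul_mod_self_right] at hmod
  have hyi : y % a = i := by
    have : y ≡ i [MOD a] := Nat.ModEq.cancel_right_of_coprime hgcd hmod
    rw [this, Nat.mod_eq_of_lt hi]
  have hle : (if IsGap K k i then a + i else i) ≤ y := by
    have hya := Nat.div_add_mod y a
    split_ifs with hgap
    · rcases Nat.eq_zero_or_pos (y / a) with h0 | hpos
      · rw [h0, hyi] at hya
        exact absurd (show IsGap K k y by rwa [← hya, mul_zero, zero_add])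
          (not_isGap_of_mul_le h₁ h₂)
      · have := Nat.mul_le_mul_left a hpos
        omega
    · rw [← hyi]; exact Nat.mod_le y a
  calc aperyElement a d K k i ≤ leastWeight a d k y := leastWeight_mono a d hle
    _ ≤ (c + t) * a + y * d := by
      have := ceil_div_le (by omega) h₂
      unfold leastWeight
      gcongr
      omega

theorem image_aperyElement_mod {a d : ℕ} (K k : ℕ) (hgcd : Nat.Coprime a d) (ha : 0 < a) :
    (range a).image (fun i => aperyElement a d K k i % a) = range a := by
  apply eq_of_subset_of_card_le
  · intro x hx
    obtain ⟨i, -, rfl⟩ := mem_image.1 hx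
    exact mem_range.2 (Nat.mod_lt _ ha)
  · rw [card_image_of_injOn]
    intro i hi j hj h
    simp only [coe_range, Set.mem_Iio] at hi hj
    simp only [aperyElement_mod] at h
    have : i ≡ j [MOD a] := Nat.ModEq.cancel_right_of_coprime hgcd h
    exact Nat.ModEq.eq_of_lt_of_lt this hi hj

/-! ### Sums over the Apéry set -/

/-- Each run of gaps is traded for its translate by `a`. Everything is written with prefix sums so
that the block formulas apply. -/
theorem sum_range_shift_gaps {a K k : ℕ} (hKk : K + 1 ≤ k) (hKl : k ≤ 2 * K) (haK : 2 * K + 1 < a)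
    (g : ℕ → ℚ) :
    ∑ i ∈ range a, g (if IsGap K k i then a + i else i) =
      ∑ i ∈ range a, g i
      + (∑ i ∈ range (a + K + 1), g i - ∑ i ∈ range (a + 1), g i)
      - (∑ i ∈ range (K + 1), g i - ∑ i ∈ range 1, g i)
      + (∑ i ∈ range (a + 2 * K + 1 + 1), g i - ∑ i ∈ range (a + k + 1), g i)
      - (∑ i ∈ range (2 * K + 1 + 1), g i - ∑ i ∈ range (k + 1), g i) := by
  have hshift (m n : ℕ) :
      ∑ i ∈ Ico m n, g (a + i) = ∑ i ∈ Ico (a + m) (a + n), g i := by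
    rw [sum_Ico_add]
    simp only [Nat.add_comm]
  have hfilter : (range a).filter (IsGap K k) = Ico 1 (K + 1) ∪ Ico (k + 1) (2 * K + 1 + 1) := by
    ext i
    simp only [mem_filter, mem_range, mem_union, mem_Ico, IsGap]
    omega
  have hdisj : Disjoint (Ico 1 (K + 1)) (Ico (k + 1) (2 * K + 1 + 1)) := by
    rw [disjoint_left]
    intro i
    simp only [mem_Ico]
    omega
  have hsplit (i : ℕ) : g (if IsGap K k i then a + i else i) =
      g i + if IsGap K k i then g (a + i) - g i else 0 := by
    split_ifs <;> ring
  rw [sum_congr rfl fun i _ => hsplit i, sum_add_distrib, ← sum_filter, hfilter,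
    sum_union hdisj, sum_sub_distrib, sum_sub_distrib, hshift, hshift,
    sum_Ico_eq_sub g (by omega), sum_Ico_eq_sub g (by omega), sum_Ico_eq_sub g (by omega),
    sum_Ico_eq_sub g (by omega)]
  simp only [← Nat.add_assoc]
  ring

/-- A function vanishing at `0` whose values on each block `m * k < y ≤ (m + 1) * k` are the
increments of `F m` has the partial sums `F m`, provided that the `F m` agree at block ends. -/
theorem sum_range_eq_of_block {k : ℕ} (g : ℕ → ℚ) (F : ℕ → ℕ → ℚ)
    (h0 : g 0 = F 0 0)
    (hend : ∀ m, F (m + 1) ((m + 1) * k) = F m ((m + 1) * k))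
    (hstep : ∀ m n, m * k ≤ n → n < (m + 1) * k → F m (n + 1) = F m n + g (n + 1))
    {m n : ℕ} (h₁ : m * k ≤ n) (h₂ : n ≤ (m + 1) * k) :
    ∑ i ∈ range (n + 1), g i = F m n := by
  have block (m : ℕ) (hm : ∑ i ∈ range (m * k + 1), g i = F m (m * k)) (t : ℕ) (ht : t ≤ k) :
      ∑ i ∈ range (m * k + t + 1), g i = F m (m * k + t) := by
    induction t with
    | zero => exact hm
    | succ t ih =>
      rw [← add_assoc, sum_range_succ, ih (by omega), hstep m _ (by omega)]
      rw [add_mul]; omega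
  have start (m : ℕ) : ∑ i ∈ range (m * k + 1), g i = F m (m * k) := by
    induction m with
    | zero => simpa using h0
    | succ m ih =>
      have := block m ih k le_rfl
      rw [hend]
      rwa [← Nat.succ_mul] at this
  obtain ⟨t, rfl⟩ := Nat.exists_eq_add_of_le h₁
  rw [add_mul] at h₂
  exact block m (start m) t (by omega)

/-- `∑ y ≤ n, leastWeight a d k y` for `m * k ≤ n ≤ (m + 1) * k`. -/
def weightSum (a d k m n : ℚ) : ℚ :=
  a * (k * m * (m + 1) / 2 + (n - m * k) * (m + 1)) + d * (n * (n + 1) / 2)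

/-- `∑ y ≤ n, leastWeight a d k y ^ 2` for `m * k ≤ n ≤ (m + 1) * k`. -/
def weightSqSum (a d k m n : ℚ) : ℚ :=
  a ^ 2 * (k * m * (m + 1) * (2 * m + 1) / 6 + (n - m * k) * (m + 1) ^ 2)
  + 2 * a * d * (k ^ 2 * (m - 1) * m * (m + 1) / 3 + k * (k + 1) * m * (m + 1) / 4
      + (m + 1) * ((n - m * k) * m * k + (n - m * k) * (n - m * k + 1) / 2))
  + d ^ 2 * (n * (n + 1) * (2 * n + 1) / 6)

theorem leastWeight_zero (a d : ℕ) {k : ℕ} (hk : 0 < k) : leastWeight a d k 0 = 0 := by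
  simp only [leastWeight, zero_add, zero_mul, add_zero]
  rw [Nat.div_eq_of_lt (by omega), zero_mul]

theorem leastWeight_succ (a d : ℕ) {k m n : ℕ} (h₁ : m * k ≤ n) (h₂ : n < (m + 1) * k) :
    (leastWeight a d k (n + 1) : ℚ) = (m + 1) * a + (n + 1) * d := by
  rw [leastWeight, ceil_div_eq (Nat.lt_succ_of_le h₁) h₂]
  push_cast; ring

theorem sum_leastWeight (a d : ℕ) {k : ℕ} (hk : 0 < k) {m n : ℕ} (h₁ : m * k ≤ n)
    (h₂ : n ≤ (m + 1) * k) :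
    ∑ i ∈ range (n + 1), (leastWeight a d k i : ℚ) = weightSum a d k m n := by
  refine sum_range_eq_of_block (k := k) _ (fun m n => weightSum a d k m n) ?_ ?_ ?_ h₁ h₂
  · simp [leastWeight_zero a d hk, weightSum]
  · intro m; simp only [weightSum]; push_cast; ring
  · intro m n h₁ h₂
    simp only [leastWeight_succ a d h₁ h₂, weightSum]; push_cast; ring

theorem sum_leastWeight_sq (a d : ℕ) {k : ℕ} (hk : 0 < k) {m n : ℕ} (h₁ : m * k ≤ n)
    (h₂ : n ≤ (m + 1) * k) :
    ∑ i ∈ range (n + 1), (leastWeight a d k i : ℚ) ^ 2 = weightSqSum a d k m n := by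
  refine sum_range_eq_of_block (k := k) _ (fun m n => weightSqSum a d k m n) ?_ ?_ ?_ h₁ h₂
  · simp [leastWeight_zero a d hk, weightSqSum]
  · intro m; simp only [weightSqSum]; push_cast; ring
  · intro m n h₁ h₂
    simp only [leastWeight_succ a d h₁ h₂, weightSqSum]; push_cast; ring

/-! ### Evaluation in the three cases -/

/-- The Sylvester sum when `a - 1`, `a`, `a + K`, `a + 2K + 1`, `a + k` lie in the blocks numbered
`m₁`, `m₁`, `m₂`, `m₃`, `m₁ + 1`. -/
theorem sylvesterSum_gapProgression {a d K k m₁ m₂ m₃ : ℕ} (hgcd : Nat.Coprime a d)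
    (hKl : k ≤ 2 * K) (hKu : 3 * K + 2 ≤ 2 * k) (haK : 2 * K + 1 < a)
    (hm₁ : m₁ * k + 1 ≤ a) (hm₁' : a ≤ (m₁ + 1) * k)
    (hm₂ : m₂ * k ≤ a + K) (hm₂' : a + K ≤ (m₂ + 1) * k)
    (hm₃ : m₃ * k ≤ a + 2 * K + 1) (hm₃' : a + 2 * K + 1 ≤ (m₃ + 1) * k)
    -- The same combination of prefix sums serves for the weights and for their squares.
    {T : (ℚ → ℚ → ℚ) → ℚ}
    (hT : ∀ F : ℚ → ℚ → ℚ, T F = F m₁ (a - 1) + (F m₂ (a + K) - F m₁ a) - (F 0 K - F 0 0)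
      + (F m₃ (a + 2 * K + 1) - F (m₁ + 1) (a + k)) - (F 1 (2 * K + 1) - F 0 k)) :
    (sylvesterSum (gapProgression a d K k) : ℚ) =
      T (weightSqSum a d k) / (2 * a) - T (weightSum a d k) / 2 + ((a : ℚ) ^ 2 - 1) / 12 := by
  have hKk : K + 1 ≤ k := by omega
  have hk : 0 < k := by omega
  have key (g : ℕ → ℚ) (F : ℚ → ℚ → ℚ)
      (hF : ∀ m n : ℕ, m * k ≤ n → n ≤ (m + 1) * k → ∑ i ∈ range (n + 1), g i = F m n) :
      ∑ i ∈ range a, g (if IsGap K k i then a + i else i) = T F := by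
    rw [sum_range_shift_gaps hKk hKl haK, hT, hF m₂ (a + K) hm₂ hm₂', hF m₁ a (by omega) hm₁',
      hF 0 K (by omega) (by omega), hF 0 0 (by omega) (by omega), hF m₃ _ hm₃ hm₃',
      hF (m₁ + 1) (a + k) (by rw [add_mul]; omega) (by rw [add_mul] at *; rw [add_mul]; omega),
      hF 1 (2 * K + 1) (by omega) (by omega), hF 0 k (by omega) (by omega)]
    obtain ⟨b, rfl⟩ : ∃ b, a = b + 1 := ⟨a - 1, by omega⟩
    rw [hF m₁ b (by omega) (by omega)]
    push_cast
    simp only [add_sub_cancel_right]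
  have ha : 0 < a := by omega
  rw [sylvesterSum_eq_of_apery ha (mem_gapProgression a d K k) (aperyElement a d K k)
    (fun i _ => aperyElement_mem hKk hKu haK i)
    (fun i hi n hn h => aperyElement_le hKk hgcd hi hn h)
    (image_aperyElement_mod K k hgcd ha)]
  unfold aperyElement
  rw [key (fun y => (leastWeight a d k y : ℚ)) (weightSum a d k)
      fun m n h₁ h₂ => sum_leastWeight a d hk h₁ h₂,
    key (fun y => (leastWeight a d k y : ℚ) ^ 2) (weightSqSum a d k)
      fun m n h₁ h₂ => sum_leastWeight_sq a d hk h₁ h₂]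

set_option maxHeartbeats 2000000 in
theorem theorem4 (a d K k r : ℕ) (ha : 2 ≤ a) (hd : 0 < d) (hK : 0 < K) (hk : 0 < k)
    (hgcd : Nat.gcd a d = 1)
    (hKl : ((k : ℚ) - 1) / 2 < K) (hKu : (K : ℚ) ≤ (2 * k - 2) / 3)
    (hr : (r : ℤ) = (a : ℤ) + K - ⌊((a : ℚ) + K) / k⌋ * k)
    (hq : 2 ≤ ⌊((a : ℚ) + K) / k⌋) :
    (nonrepresentable (gapProgression a d K k)).Finite ∧
    ((0 : ℤ) ≤ r ∧ (r : ℤ) ≤ (k : ℤ) - K - 1 →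
      (sylvesterSum (gapProgression a d K k) : ℚ) =
        1 / (12 * (k : ℚ) ^ 2) *
          (2 * a ^ 4 + 6 * (3 * K - k) * a ^ 3
            + (30 * K ^ 2 - 7 * k ^ 2 + 12 * k - 6 * (r + 4 * K - 3 * k) * r) * a ^ 2
            + (K ^ 2 * (14 * K + 6 * k) - 4 * K * k * (8 * k - 3) + 12 * k ^ 2 * (k - 1)
                + 4 * r ^ 3 + 6 * (K - 2 * k) * r ^ 2
                - (24 * K ^ 2 - 6 * K * k - 8 * k ^ 2 + 12 * k) * r) * a
            - k ^ 2
            + (2 * a ^ 2 + 3 * (6 * K - 2 * k + 1) * a + 6 * K * (5 * K + 7)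
                - (6 * k ^ 2 + 6 * k - 13)) * k ^ 2 * d ^ 2
            + (4 * a ^ 3 + 3 * (12 * K - 4 * k + 1) * a ^ 2
                + (6 * K * (10 * K + 7) - (13 * k ^ 2 - 6 * k - 12)
                    - 6 * r * (r + 4 * K - 3 * k)) * a
                + 28 * K ^ 3 - K ^ 2 * (27 * k - 39) - K * (7 * k ^ 2 + 45 * k - 12)
                + 6 * (k - 1) * k * (k + 2)
                + 2 * r ^ 3 - 3 * r ^ 2 * (2 * K + k + 1)
                + r * (-6 * K * (4 * K - k + 6) + 7 * k ^ 2 + 9 * k - 12)) * k * d)) ∧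
    ((k : ℤ) - K ≤ r ∧ r ≤ K →
      (sylvesterSum (gapProgression a d K k) : ℚ) =
        1 / (12 * (k : ℚ) ^ 2) *
          (2 * a ^ 4 + 6 * (3 * K - k) * a ^ 3
            + (30 * K ^ 2 + 12 * K * k - 19 * k ^ 2 + 24 * k
                - 6 * (r + 4 * K - 5 * k) * r) * a ^ 2
            + (K ^ 2 * (14 * K + 18 * k) - 8 * K * k * (4 * k - 3)
                + 4 * r ^ 3 + 6 * (K - 4 * k) * r ^ 2
                - (24 * K ^ 2 - 6 * K * k - 32 * k ^ 2 + 24 * k) * r) * a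
            - k ^ 2
            + (2 * a ^ 2 + 3 * (6 * K - 2 * k + 1) * a + 6 * K * (5 * K + 7)
                - 6 * k ^ 2 - 6 * k + 13) * k ^ 2 * d ^ 2
            + (4 * a ^ 3 + 3 * (12 * K - 4 * k + 1) * a ^ 2
                + (6 * K * (10 * K + 2 * k + 7) - (25 * k ^ 2 - 18 * k - 12)
                    - 6 * r * (r + 4 * K - 5 * k)) * a
                + 28 * K ^ 3 - K ^ 2 * (9 * k - 39) - K * (19 * k ^ 2 + 15 * k - 12)
                + 2 * r ^ 3 - 3 * r ^ 2 * (2 * K + 3 * k + 1)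
                + r * (-K * (24 * K - 18 * k + 36) + (19 * k ^ 2 + 15 * k - 12))) * k * d)) ∧
    (K + 1 ≤ r ∧ r < k →
      (sylvesterSum (gapProgression a d K k) : ℚ) =
        1 / (12 * (k : ℚ) ^ 2) *
          (2 * a ^ 4 + 6 * (3 * K - k) * a ^ 3
            + (30 * K ^ 2 + 24 * K * k - 19 * k ^ 2 + 12 * k
                - 6 * (r + 4 * K - 3 * k) * r) * a ^ 2
            + (K ^ 2 * (14 * K + 30 * k) - 4 * K * k * (5 * k - 3)
                + 4 * r ^ 3 + 6 * (K - 2 * k) * r ^ 2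
                - (24 * K ^ 2 + 18 * K * k - 20 * k ^ 2 + 12 * k) * r) * a
            - k ^ 2
            + (2 * a ^ 2 + 3 * (6 * K - 2 * k + 1) * a + 6 * K * (5 * K + 7)
                - 6 * k ^ 2 - 6 * k + 13) * k ^ 2 * d ^ 2
            + (4 * a ^ 3 + 3 * (12 * K - 4 * k + 1) * a ^ 2
                + (6 * K * (10 * K + 4 * k + 7) - (25 * k ^ 2 - 6 * k - 12)
                    - 6 * r * (r + 4 * K - 3 * k)) * a
                + 28 * K ^ 3 - 3 * K ^ 2 * (k - 13) - K * (7 * k ^ 2 + 9 * k - 12)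
                + 2 * r ^ 3 - 3 * r ^ 2 * (2 * K + k + 1)
                + r * (-6 * K * (4 * K - k + 6) + 7 * k ^ 2 + 9 * k - 12)) * k * d)) := by
  have hk0 : (0 : ℚ) < k := by exact_mod_cast hk
  have hKl' : k ≤ 2 * K := by
    have : (k : ℚ) < 2 * K + 1 := by linarith
    exact Nat.lt_succ_iff.1 (by exact_mod_cast this)
  have hKu' : 3 * K + 2 ≤ 2 * k := by
    have : (3 * K + 2 : ℚ) ≤ 2 * k := by linarith
    exact_mod_cast this
  have hfloor : ⌊((a : ℚ) + K) / k⌋ = (((a + K) / k : ℕ) : ℤ) := by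
    rw [← Nat.cast_add, ← Rat.natFloor_natCast_div_natCast, Int.natCast_floor_eq_floor]
    positivity
  rw [hfloor] at hr hq
  have hrk : r < k := by
    have h₁ := Nat.div_add_mod' (a + K) k
    have h₂ := Nat.mod_lt (a + K) hk
    zify at h₁ h₂ ⊢
    push_cast at hr
    linarith
  obtain ⟨q, hqe⟩ : ∃ q, (a + K) / k = q + 1 := ⟨(a + K) / k - 1, by omega⟩
  have hak : a + K = q * k + k + r := by
    rw [hqe] at hr
    zify
    push_cast at hr
    linarith
  have hq1 : 1 ≤ q := by omega
  have hqk : k ≤ q * k := Nat.le_mul_of_pos_left k hq1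
  -- `a ≥ 2k - K ≥ 2K + 2`.
  have haK : 2 * K + 1 < a := by omega
  have hqQ : (q : ℚ) = (a + K - r) / k - 1 := by
    have : (a + K : ℚ) = q * k + k + r := by exact_mod_cast hak
    rw [this]; field_simp; ring
  have ha0 : (a : ℚ) ≠ 0 := by positivity
  -- These make the block bounds linear in the atom `q * k` for `omega`.
  have e₁ : (q + 1) * k = q * k + k := by ring
  have e₂ : (q + 1 + 1) * k = q * k + k + k := by ring
  have e₃ : (q + 1 + 1 + 1) * k = q * k + k + k + k := by ring
  refine ⟨?_, ?_, ?_, ?_⟩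
  · rw [nonrepresentable_eq_image (by omega) (mem_gapProgression a d K k) (aperyElement a d K k)
      (fun i _ => aperyElement_mem (by omega) hKu' haK i)
      (fun i hi n hn h => aperyElement_le (by omega) hgcd hi hn h)
      (image_aperyElement_mod K k hgcd (by omega))]
    exact finite_toSet _
  · rintro ⟨-, h⟩
    -- Here `a = (q+1)k + r - K ≤ (q+1)k`, and `a + 2K + 1 = (q+1)k + r + K + 1 ≤ (q+2)k`.
    rw [sylvesterSum_gapProgression (m₁ := q) (m₂ := q + 1) (m₃ := q + 1) hgcd hKl' hKu' haK
      (by omega) (by omega) (by omega) (by omega) (by omega) (by omega) fun _ => rfl]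
    simp only [weightSqSum, weightSum]
    push_cast
    rw [hqQ]
    field_simp
    ring
  · rintro ⟨h, h'⟩
    -- Still `a ≤ (q+1)k`, but now `a + 2K + 1` exceeds `(q+2)k`.
    rw [sylvesterSum_gapProgression (m₁ := q) (m₂ := q + 1) (m₃ := q + 1 + 1) hgcd hKl' hKu' haK
      (by omega) (by omega) (by omega) (by omega) (by omega) (by omega) fun _ => rfl]
    simp only [weightSqSum, weightSum]
    push_cast
    rw [hqQ]
    field_simp
    ring
  · rintro ⟨h, -⟩
    -- Now `a` also exceeds `(q+1)k`.
    rw [sylvesterSum_gapProgression (m₁ := q + 1) (m₂ := q + 1) (m₃ := q + 1 + 1) hgcd hKl' hKu' haK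
      (by omega) (by omega) (by omega) (by omega) (by omega) (by omega) fun _ => rfl]
    simp only [weightSqSum, weightSum]
    push_cast
    rw [hqQ]
    field_simp
    ring
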